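/- **Setting.** In a system of $n$ asynchronous crash-prone processes $\Pi=\{p_1,\dots,p_n\}$, let $\Pi_M,\Pi_V\subseteq\Pi$ (the managers and the verifiers) and let $\mathcal S$ be a nonempty set of values contained in a universe $V$. The *DenyList* object with parameters $(\Pi_M,\Pi_V,\mathcal S)$ supports the atomic operations $\mathrm{APPEND}(x)$, $\mathrm{PROVE}(x)$ for $x\in V$, and $\mathrm{READ}()$. Each APPEND and each PROVE responds whether it is valid, and the sequence $\mathsf{Seq}$ (finite or infinite) of the operations performed on the object satisfies the following properties, and is otherwise arbitrary: * *APPEND validity*: an $\mathrm{APPEND}(x)$ by $p$ is valid if $p\in\Pi_M$ and $x\in\mathcal S$, and invalid otherwise. * *PROVE validity*: a $\mathrm{PROVE}(x)$ by $p\notin\Pi_V$ is invalid; a $\mathrm{PROVE}(x)$ by $p\in\Pi_V$ can be invalid only if a valid $\mathrm{APPEND}(x)$ appears before it in $\mathsf{Seq}$. * *Anti-flickering*: if a $\mathrm{PROVE}(x)$ by some $p\in\Pi_V$ is invalid, then every later $\mathrm{PROVE}(x)$ is invalid. * *Progress*: if a valid $\mathrm{APPEND}(x)$ appears in $\mathsf{Seq}$,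 then there is a point of $\mathsf{Seq}$ after which every $\mathrm{PROVE}(x)$ is invalid. * *READ validity*: a READ by any process returns, in an arbitrary order, the list of the valid $\mathrm{PROVE}$ invocations that appear before it in $\mathsf{Seq}$, each with the process that invoked it. The *$k$-DenyList* object type over $\mathcal S$ consists of the DenyList objects with $|\Pi_V|=k$ and arbitrary $\Pi_M$. The *consensus number* of an object type $T$ is the largest $n$ such that in a system of $n$ processes a consensus object (validity, agreement, termination) can be wait-free implemented, by a deterministic algorithm, from atomic read/write registers and objects of type $T$. The implementation may use any number of these objects, choosing for each one its static parameters, and must be correct in all executions that the specifications of the objects allow. **Theorem.** For every $k\ge 1$, every nonempty $\mathcal S$, and consensus over any value set with at least two elements, the $k$-DenyList object type over $\mathcal S$ has consensus number exactly $k$. -/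

import Mathlib

/-! ### Shared objects -/

/-- An operation on a shared object, performed atomically: the calling process, the operation
invoked and the response returned. -/
structure Event (P Op Resp : Type) where
  proc : P
  op : Op
  resp : Resp

/-- A sequential history of one shared object, finite or infinite. `H t` is the operation performed
on the object at time `t`, and is `none` if the object is not accessed at time `t`. -/
abbrev History (P Op Resp : Type) := ℕ → Option (Event P Op Resp)

/-- A (sequentially specified) shared object accessed by the processes `P`: its operations, its
responses, and the set of its allowed histories. The specification may be nondeterministic, and may
restrict infinite histories. -/
structure ObjectType (P : Type) where
  Op : Type
  Resp : Type
  spec : Set (History P Op Resp)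

/-! ### Atomic read/write registers -/

inductive RegOp (A : Type) where
  | read
  | write (a : A)

inductive RegResp (A : Type) where
  | value (a : A)
  | ack

/-- One transition of a register whose content changes from `a` to `b`. -/
def RegStep {P A : Type} (a b : A) : Option (Event P (RegOp A) (RegResp A)) → Prop
  | none => b = a
  | some ⟨_, .read, r⟩ => r = .value a ∧ b = a
  | some ⟨_, .write c, r⟩ => r = .ack ∧ b = c

/-- The multi-writer multi-reader atomic register with values in `A` and initial value `a₀`. -/
def register (P A : Type) (a₀ : A) : ObjectType P where
  Op := RegOp A
  Resp := RegResp A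
  spec := {H | ∃ content : ℕ → A, content 0 = a₀ ∧
    ∀ t, RegStep (content t) (content (t + 1)) (H t)}

/-! ### DenyLists -/

inductive DenyOp (V : Type) where
  | append (x : V)
  | prove (x : V)
  | read

/-- `accept` is the response to a valid APPEND or PROVE, `reject` the response to an invalid one;
`proofs l` is the response to a READ. -/
inductive DenyResp (P V : Type) where
  | accept
  | reject
  | proofs (l : List (P × V))

/-- The history of a DenyList contains a valid APPEND(`x`) at time `t`. -/
def ValidAppend {P V : Type} (H : History P (DenyOp V) (DenyResp P V)) (t : ℕ) (x : V) : Prop :=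
  ∃ p, H t = some ⟨p, .append x, .accept⟩

/-- If the given event is a valid PROVE(`x`) by `p`, the pair `(p, x)`. -/
def validProve? {P V : Type} : Option (Event P (DenyOp V) (DenyResp P V)) → Option (P × V)
  | some ⟨p, .prove x, .accept⟩ => some (p, x)
  | _ => none

/-- The list of the valid PROVE invocations before time `t`, each with the process invoking it. -/
def validProves {P V : Type} (H : History P (DenyOp V) (DenyResp P V)) (t : ℕ) : List (P × V) :=
  (List.range t).filterMap fun s => validProve? (H s)

/-- `H` is an allowed history of the DenyList with managers `managers`, verifiers `verifiers` and
set of listable values `S`. -/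
structure IsDenyListHistory {P V : Type} (managers verifiers : Finset P) (S : Set V)
    (H : History P (DenyOp V) (DenyResp P V)) : Prop where
  /-- APPEND validity. -/
  append_validity : ∀ t p x r, H t = some ⟨p, .append x, r⟩ →
    (r = .accept ∧ p ∈ managers ∧ x ∈ S) ∨ (r = .reject ∧ ¬ (p ∈ managers ∧ x ∈ S))
  /-- A PROVE is either valid or invalid. -/
  prove_response : ∀ t p x r, H t = some ⟨p, .prove x, r⟩ → r = .accept ∨ r = .reject
  /-- PROVE validity: the PROVE of a verifier is invalid only after a valid APPEND. -/
  prove_validity : ∀ t p x, p ∈ verifiers → H t = some ⟨p, .prove x, .reject⟩ →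
    ∃ s < t, ValidAppend H s x
  /-- Only verifiers are authorized to conduct proofs. -/
  prove_authorized : ∀ t p x r, p ∉ verifiers → H t = some ⟨p, .prove x, r⟩ → r = .reject
  /-- PROVE anti-flickering. -/
  anti_flickering : ∀ s t p q x r, s < t → p ∈ verifiers →
    H s = some ⟨p, .prove x, .reject⟩ → H t = some ⟨q, .prove x, r⟩ → r = .reject
  /-- Progress: after a valid APPEND(`x`), there is a point after which every PROVE(`x`) is
  invalid. -/
  progress : ∀ s x, ValidAppend H s x → ∃ T, ∀ t ≥ T, ∀ p ∈ verifiers, ∀ r,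
    H t = some ⟨p, .prove x, r⟩ → r = .reject
  /-- READ validity: a READ by any process returns, in an arbitrary order, the valid PROVE
  invocations that precede it. -/
  read_validity : ∀ t p r, H t = some ⟨p, .read, r⟩ →
    ∃ l, r = .proofs l ∧ l.Perm (validProves H t)

/-- The DenyList object. -/
def denyList {P V : Type} (managers verifiers : Finset P) (S : Set V) : ObjectType P where
  Op := DenyOp V
  Resp := DenyResp P V
  spec := {H | IsDenyListHistory managers verifiers S H}

/-! ### Algorithms and their executions -/

/-- What a process does next: output a decision, or invoke `op` on the shared object `o` and
continue in the local state `next r` when the response is `r`. -/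
inductive LocalAction {P : Type} (Obj : Type) (type : Obj → ObjectType P) (State Val : Type) where
  | output (v : Val)
  | invoke (o : Obj) (op : (type o).Op) (next : (type o).Resp → State)

/-- A deterministic algorithm for `n` processes `Fin n`, each receiving an input in `Val`, that
communicate through the shared objects `Obj`. -/
structure Algorithm (n : ℕ) (Val : Type) where
  Obj : Type
  type : Obj → ObjectType (Fin n)
  State : Type
  init : Fin n → Val → State
  act : Fin n → State → LocalAction Obj type State Val

/-- An asynchronous execution of the algorithm `A`, finite or infinite, with inputs `input`.
At time `t` the process `sched t` takes a step (nobody does if it is `none`); `state t p` is the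
local state of `p` before that step, and `hist o` is the history of the object `o`. A process
crashes by not being scheduled any more; a process that has decided takes idle steps. -/
structure Execution {n : ℕ} {Val : Type} (A : Algorithm n Val) (input : Fin n → Val) where
  sched : ℕ → Option (Fin n)
  state : ℕ → Fin n → A.State
  hist : (o : A.Obj) → History (Fin n) (A.type o).Op (A.type o).Resp
  state_zero : ∀ p, state 0 p = A.init p (input p)
  idle : ∀ t, sched t = none → state (t + 1) = state t ∧ ∀ o, hist o t = none
  halted : ∀ t p v, sched t = some p → A.act p (state t p) = .output v →
    state (t + 1) = state t ∧ ∀ o, hist o t = none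
  step : ∀ t p o op next, sched t = some p → A.act p (state t p) = .invoke o op next →
    (∃ r, hist o t = some ⟨p, op, r⟩ ∧ state (t + 1) = Function.update (state t) p (next r)) ∧
      ∀ o', o' ≠ o → hist o' t = none
  legal : ∀ o, hist o ∈ (A.type o).spec

namespace Execution

variable {n : ℕ} {Val : Type} {A : Algorithm n Val} {input : Fin n → Val}

/-- The process `p` has started its algorithm (that is, has invoked `propose (input p)`) before
time `t`. -/
def Started (E : Execution A input) (p : Fin n) (t : ℕ) : Prop :=
  ∃ s < t, E.sched s = some p

/-- At time `t` the process `p` has decided the value `v`. -/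
def Decides (E : Execution A input) (p : Fin n) (v : Val) (t : ℕ) : Prop :=
  E.Started p t ∧ A.act p (E.state t p) = .output v

end Execution

/-! ### Consensus numbers -/

/-- The algorithm is a wait-free implementation of a consensus object: in each execution validity
and agreement hold, and each process that keeps taking steps decides. -/
structure Algorithm.SolvesConsensus {n : ℕ} {Val : Type} (A : Algorithm n Val) : Prop where
  validity : ∀ (input : Fin n → Val) (E : Execution A input) p v t,
    E.Decides p v t → ∃ q, E.Started q t ∧ input q = v
  agreement : ∀ (input : Fin n → Val) (E : Execution A input) p q v w s t,
    E.Decides p v s → E.Decides q w t → v = w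
  termination : ∀ (input : Fin n → Val) (E : Execution A input) p,
    (∀ s, ∃ t ≥ s, E.sched t = some p) → ∃ v t, E.Decides p v t

/-- Consensus on values in `Val` has a wait-free implementation in the system of `n` processes from
atomic read/write registers and objects of type `T`. Here `T n` is the set of the objects of type
`T` that exist in a system of `n` processes. -/
def ConsensusSolvable (T : (n : ℕ) → Set (ObjectType (Fin n))) (Val : Type) (n : ℕ) : Prop :=
  ∃ A : Algorithm n Val,
    (∀ o, A.type o ∈ T n ∨ ∃ (B : Type) (b : B), A.type o = register (Fin n) B b) ∧
      A.SolvesConsensus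

/-- The object type `T` has consensus number `k`: `k` is the largest number of processes for which
`T` and registers solve consensus. -/
def HasConsensusNumber (T : (n : ℕ) → Set (ObjectType (Fin n))) (Val : Type) (k : ℕ) : Prop :=
  IsGreatest {n | ConsensusSolvable T Val n} k

/-- The `k`-DenyList object type over the set of listable values `S`: DenyLists with exactly `k`
verifiers, and an arbitrary set of managers. -/
def kDenyList {V : Type} (S : Set V) (k n : ℕ) : Set (ObjectType (Fin n)) :=
  {X | ∃ managers verifiers : Finset (Fin n), verifiers.card = k ∧
    X = denyList managers verifiers S}

/-!
*Lower bound.* All `k` processes are managers and verifiers of one DenyList. A process announces its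
input in its own register, PROVEs a listable value `x` once, APPENDs `x`, repeats the PROVE until it
is rejected, and then READs (`verifierConsensus`). Progress makes the loop end. By anti-flickering
the set of valid PROVEs is final from the first rejection on, so that all READs that matter return
the same proofs up to order, and all processes agree on the smallest process in the list. There is
such a process, because a PROVE can be rejected only after an APPEND, and before its APPEND each
process has called PROVE; the first PROVE of all is therefore valid.

*Upper bound.* A DenyList that rejects every PROVE from the APPEND on would be too strong: a manager
that is not a verifier could find out with one READ whether its APPEND came before the PROVE of a
verifier. So the adversary lets each PROVE take effect in two atomic steps: the caller first peeks
whether `x` has been appended, and later performs the PROVE, which is rejected if the answer was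
positive or if a PROVE of `x` has already been rejected. An APPEND between the two steps has no
influence on the PROVE. All infinite interleavings of these steps yield allowed histories
(`IsDenyRun.isDenyListHistory`): after an APPEND each process can have at most one more PROVE
accepted, namely one that had peeked before, which is why Progress holds.

With these deterministic objects the classical valency argument applies (`not_bivalent`). As every
infinite run is an execution, in which some process decides, a bivalent configuration leads to a
critical one, where the next steps of some `p` and `q` fix different decisions. These steps must
access the same object. If this is a DenyList with `k` verifiers and there are more than `k`
processes, some process `r` is not a verifier; its APPENDs commute with PROVEs, and its other
operations leave no trace, so its next step is compatible with those of `p` and of `q`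
(`DenyMem.compatible_apply`). Hence it fixes both decisions, which is absurd. On a register all
operations are compatible in this sense.
-/

/-! ### Valency in deterministic systems -/

section Valency

variable {Config P Val : Type} (step : Config → P → Config) (decided : Config → P → Val → Prop)

/-- Some continuation of the configuration `C` leads to a configuration in which some process has
decided `v`. -/
def Reaches (C : Config) (v : Val) : Prop :=
  ∃ C', Relation.ReflTransGen (fun D D' => ∃ p, D' = step D p) C C' ∧ ∃ p, decided C' p v

/-- At least two different decisions are still possible. -/
def Bivalent (C : Config) : Prop :=
  ∃ v w, v ≠ w ∧ Reaches step decided C v ∧ Reaches step decided C w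

/-- The order in which `p` and `q` take their steps from `C` is hidden from some process: the steps
commute, or after the step of `q` only `p` can tell whether `p` moved first, or conversely. Here
`like p C C'` means that at most `p` can tell `C` from `C'`. -/
def StepsCompatible (like : P → Config → Config → Prop) (C : Config) (p q : P) : Prop :=
  step (step C p) q = step (step C q) p ∨
    like p (step (step C p) q) (step C q) ∨ like q (step (step C q) p) (step C p)

variable {step decided}

theorem Reaches.of_step {C : Config} {p : P} {v : Val} (h : Reaches step decided (step C p) v) :
    Reaches step decided C v := by
  obtain ⟨C', hC', hv⟩ := h
  exact ⟨C', .head ⟨p, rfl⟩ hC', hv⟩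

theorem reaches_of_solo {q : P} {c : ℕ → Config} (hc : ∀ t, c (t + 1) = step (c t) q) {t : ℕ}
    {v : Val} (h : decided (c t) q v) : Reaches step decided (c 0) v := by
  refine ⟨c t, ?_, q, h⟩
  clear h
  induction t with
  | zero => exact .refl
  | succ t ih => exact ih.tail ⟨q, hc t⟩

/-- A deterministic system in which every process that takes infinitely many steps decides, in
agreement with the others, has no bivalent configuration, provided that for any two processes there
is a third one (or one of the two) whose next step is compatible with both of theirs. Otherwise a
bivalent configuration would have a critical descendant, bivalent without bivalent successors, from
which the steps of some `p` and `q` fix different decisions; but a step compatible with that of `p`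
fixes the same decision as that of `p`, and likewise for `q`. -/
theorem not_bivalent [Finite P] (like : P → Config → Config → Prop) (Reachable : Config → Prop)
    (reachable_step : ∀ C p, Reachable C → Reachable (step C p))
    (persistent : ∀ C p q v, decided C p v → decided (step C q) p v)
    (agreement : ∀ C p q v w, Reachable C → decided C p v → decided C q w → v = w)
    (termination : ∀ (c : ℕ → Config) (τ : ℕ → P) p, Reachable (c 0) →
      (∀ t, c (t + 1) = step (c t) (τ t)) → (∀ s, ∃ t ≥ s, τ t = p) → ∃ t v, decided (c t) p v)
    (like_step : ∀ p q C C', p ≠ q → like p C C' → like p (step C q) (step C' q))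
    (like_decided : ∀ p q C C' v, p ≠ q → like p C C' → decided C q v → decided C' q v)
    (compatible : ∀ C, Reachable C → (∀ p v, ¬ decided C p v) → ∀ p q, ∃ r,
      (r ≠ p → StepsCompatible step like C r p) ∧ (r ≠ q → StepsCompatible step like C r q))
    (C : Config) (hC : Reachable C) : ¬ Bivalent step decided C := by
  intro hbiv
  have undecided : ∀ C, Reachable C → Bivalent step decided C → ∀ p v, ¬ decided C p v := by
    rintro C hC ⟨v, w, hvw, hv, hw⟩ p u hu
    have key : ∀ v, Reaches step decided C v → u = v := by
      rintro v ⟨C', hC', q, hq⟩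
      have : Reachable C' ∧ decided C' p u := by
        clear hq
        induction hC' with
        | refl => exact ⟨hC, hu⟩
        | tail _ h ih =>
          obtain ⟨r, rfl⟩ := h
          exact ⟨reachable_step _ _ ih.1, persistent _ _ _ _ ih.2⟩
      exact agreement _ _ _ _ _ this.1 this.2 hq
    exact hvw ((key v hv).symm.trans (key w hw))
  have solo : ∀ C q, Reachable C →
      ∃ t v, decided ((fun D => step D q)^[t] C) q v := by
    intro C q hC
    refine termination (fun t => (fun D => step D q)^[t] C) (fun _ => q) q hC (fun t => ?_)
      (fun s => ⟨s, le_rfl, rfl⟩)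
    simp only [Function.iterate_succ_apply']
  have reaches_solo : ∀ C q t v, decided ((fun D => step D q)^[t] C) q v →
      Reaches step decided C v := by
    intro C q t v h
    exact reaches_of_solo (c := fun t => (fun D => step D q)^[t] C)
      (fun t => by simp only [Function.iterate_succ_apply']) h
  -- Compatible steps lead to configurations with a common possible decision.
  have common_of_like : ∀ C p q, p ≠ q → Reachable C →
      like p (step (step C p) q) (step C q) →
      ∃ v, Reaches step decided (step C p) v ∧ Reaches step decided (step C q) v := by
    intro C p q hpq hC h
    obtain ⟨t, v, hv⟩ := solo (step (step C p) q) q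
      (reachable_step _ _ (reachable_step _ _ hC))
    refine ⟨v, (reaches_solo _ _ _ _ hv).of_step, reaches_solo _ q t _ ?_⟩
    refine like_decided p q _ _ v hpq ?_ hv
    clear hv
    induction t with
    | zero => exact h
    | succ t ih =>
      simp only [Function.iterate_succ_apply']
      exact like_step _ _ _ _ hpq ih
  have common : ∀ C p q, p ≠ q → Reachable C → StepsCompatible step like C p q →
      ∃ v, Reaches step decided (step C p) v ∧ Reaches step decided (step C q) v := by
    rintro C p q hpq hC (h | h | h)
    · obtain ⟨t, v, hv⟩ := solo (step (step C p) q) q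
        (reachable_step _ _ (reachable_step _ _ hC))
      have hv := reaches_solo _ _ _ _ hv
      exact ⟨v, hv.of_step, (h ▸ hv).of_step⟩
    · exact common_of_like C p q hpq hC h
    · obtain ⟨v, hq, hp⟩ := common_of_like C q p hpq.symm hC h
      exact ⟨v, hp, hq⟩
  have successor : ∀ C v, Reachable C → Bivalent step decided C → Reaches step decided C v →
      ∃ p, Reaches step decided (step C p) v := by
    rintro C v hC hb ⟨C', hC', p, hp⟩
    obtain rfl | ⟨D, ⟨q, rfl⟩, hD⟩ := hC'.cases_head
    · exact absurd hp (undecided _ hC hb p v)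
    · exact ⟨q, C', hD, p, hp⟩
  -- There is no critical configuration.
  have extend : ∀ C, Reachable C → Bivalent step decided C →
      ∃ p, Bivalent step decided (step C p) := by
    intro C hC hb
    by_contra! hcrit
    have unique : ∀ p v w, Reaches step decided (step C p) v → Reaches step decided (step C p) w →
        v = w := fun p v w hv hw => by
      by_contra hvw
      exact hcrit p ⟨v, w, hvw, hv, hw⟩
    obtain ⟨v, w, hvw, hv, hw⟩ := id hb
    obtain ⟨p, hp⟩ := successor C v hC hb hv
    obtain ⟨q, hq⟩ := successor C w hC hb hw
    obtain ⟨r, hrp, hrq⟩ := compatible C hC (undecided C hC hb) p q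
    have key : ∀ p v, Reaches step decided (step C p) v →
        (r ≠ p → StepsCompatible step like C r p) → Reaches step decided (step C r) v := by
      intro p v hp hrp
      by_cases h : r = p
      · exact h ▸ hp
      · obtain ⟨u, hu, hu'⟩ := common C r p h hC (hrp h)
        exact unique p _ _ hp hu' ▸ hu
    exact hvw (unique r _ _ (key p v hp hrp) (key q w hq hrq))
  have : Nonempty P := ⟨(extend C hC hbiv).choose⟩
  choose! next hnext using extend
  let c : ℕ → Config := fun t => (fun D => step D (next D))^[t] C
  have hc : ∀ t, c (t + 1) = step (c t) (next (c t)) := fun t => by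
    simp only [c, Function.iterate_succ_apply']
  have inv : ∀ t, Reachable (c t) ∧ Bivalent step decided (c t) := by
    intro t
    induction t with
    | zero => exact ⟨hC, hbiv⟩
    | succ t ih =>
      rw [hc]
      exact ⟨reachable_step _ _ ih.1, hnext _ ih.1 ih.2⟩
  obtain ⟨p, hp⟩ := Finite.exists_infinite_fiber fun t => next (c t)
  obtain ⟨t, v, hv⟩ := termination c (fun t => next (c t)) p hC hc fun s => by
    obtain ⟨t, ht, hst⟩ := (Set.infinite_coe_iff.mp hp).exists_gt s
    exact ⟨t, hst.le, ht⟩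
  exact undecided _ (inv t).1 (inv t).2 p v hv

end Valency

/-! ### Deterministic realizations of shared objects -/

/-- The order of the atomic steps `f` and `g`, taken from the content `m` of a memory, is hidden from
the caller of one of them: they commute, or `g` has the same effect whether or not `f` precedes it,
or conversely. -/
def Compatible {M α β : Type} (f : M → M × α) (g : M → M × β) (m : M) : Prop :=
  ((g (f m).1).1 = (f (g m).1).1 ∧ (g (f m).1).2 = (g m).2 ∧ (f (g m).1).2 = (f m).2) ∨
    g (f m).1 = g m ∨ f (g m).1 = f m

/-- A deterministic realization of a shared object by a memory, in which each operation is carried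
out in two atomic steps: the caller first extracts one bit from the memory by `peek`, and later it
performs the operation by `apply`, with this bit as an additional argument. -/
structure Realization {P : Type} (X : ObjectType P) where
  Mem : Type
  init : Mem
  peek : Mem → P → X.Op → Bool
  apply : P → X.Op → Bool → Mem → Mem × X.Resp
  /-- However the steps are interleaved, the resulting history is allowed. Here `m` is the content
  of the memory over time, `t` the time of the second step of an operation and `t₀` the time of
  its first step. -/
  legal : ∀ (m : ℕ → Mem) (H : History P X.Op X.Resp), m 0 = init →
    (∀ t, (H t = none ∧ m (t + 1) = m t) ∨ ∃ p op, ∃ t₀ ≤ t,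
      (∀ u, t₀ ≤ u → u < t → ∀ e, H u = some e → e.proc ≠ p) ∧
      H t = some ⟨p, op, (apply p op (peek (m t₀) p op) (m t)).2⟩ ∧
      m (t + 1) = (apply p op (peek (m t₀) p op) (m t)).1) →
    H ∈ X.spec
  /-- A process whose operations do not compete with those of the others. -/
  neutral : P
  compatible : ∀ q, q ≠ neutral → ∀ op op' b b' m,
    Compatible (apply neutral op b) (apply q op' b') m

theorem Compatible.of_left {M α β : Type} {f : M → M × α} {g : M → M × β} {m : M}
    (h : (f m).1 = m) : Compatible f g m := by
  right; left; rw [h]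

theorem Compatible.of_right {M α β : Type} {f : M → M × α} {g : M → M × β} {m : M}
    (h : (g m).1 = m) : Compatible f g m := by
  right; right; rw [h]

/-- The next atomic step of a process that carries out `op`: it peeks if it has not done so yet,
and otherwise performs the operation with the bit obtained. -/
def Realization.micro {P : Type} {X : ObjectType P} (R : Realization X) (p : P) (op : X.Op) :
    Option Bool → R.Mem → R.Mem × (Bool ⊕ X.Resp)
  | none, m => (m, .inl (R.peek m p op))
  | some b, m => ((R.apply p op b m).1, .inr (R.apply p op b m).2)

theorem Realization.compatible_micro {P : Type} {X : ObjectType P} (R : Realization X) {q : P}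
    (hq : q ≠ R.neutral) (op op' : X.Op) (b b' : Option Bool) (m : R.Mem) :
    Compatible (R.micro R.neutral op b) (R.micro q op' b') m := by
  rcases b with _ | b
  · exact .of_left rfl
  rcases b' with _ | b'
  · exact .of_right rfl
  rcases R.compatible q hq op op' b b' m with ⟨h₁, h₂, h₃⟩ | h | h
  · left; simp [micro, h₁, h₂, h₃]
  · right; left; simp [micro, h]
  · right; right; simp [micro, h]

/-- A register needs no peeking, and all its operations are compatible. -/
def registerRealization {P A : Type} (a₀ : A) (r : P) : Realization (register P A a₀) where
  Mem := A
  init := a₀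
  peek _ _ _ := false
  apply _ op _ a := match op with
    | .read => (a, .value a)
    | .write c => (c, .ack)
  legal m H h₀ h := by
    refine ⟨m, h₀, fun t => ?_⟩
    rcases h t with ⟨h, h'⟩ | ⟨p, op, t₀, -, -, h, h'⟩
    · rw [h]; exact h'
    · rw [h]
      cases op
      · exact ⟨rfl, h'⟩
      · exact ⟨rfl, h'⟩
  neutral := r
  compatible q _ op op' b b' m := by
    cases op with
    | read => exact .of_left rfl
    | write c =>
      cases op' with
      | read => exact .of_right rfl
      | write c' => right; left; rfl

/-! ### A deterministic realization of the DenyList -/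

/-- The content of a DenyList: the values appended, the values all of whose proofs are rejected from
now on, and the valid proofs. -/
structure DenyMem (P V : Type) where
  appended : Set V
  rejecting : Set V
  proofs : Multiset (P × V)

open Classical in
/-- Peeking tells a process that is about to prove `x` whether `x` has been appended. -/
noncomputable def DenyMem.peek {P V : Type} (m : DenyMem P V) (_ : P) : DenyOp V → Bool
  | .prove x => decide (x ∈ m.appended)
  | _ => false

open Classical in
/-- A PROVE is rejected if `x` had been appended when its caller peeked, or if a PROVE of `x` has
been rejected before. So a PROVE remains insensitive to an APPEND that comes after its first
step. -/
noncomputable def DenyMem.apply {P V : Type} (managers verifiers : Finset P) (S : Set V) (p : P) :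
    DenyOp V → Bool → DenyMem P V → DenyMem P V × DenyResp P V
  | .append x, _, m => if p ∈ managers ∧ x ∈ S then
      ({ m with appended := insert x m.appended }, .accept) else (m, .reject)
  | .prove x, b, m => if p ∈ verifiers then
      if b = true ∨ x ∈ m.rejecting then
        ({ m with rejecting := insert x m.rejecting }, .reject)
      else ({ m with proofs := (p, x) ::ₘ m.proofs }, .accept)
      else (m, .reject)
  | .read, _, m => (m, .proofs m.proofs.toList)

theorem DenyMem.peek_prove {P V : Type} {m : DenyMem P V} {p : P} {x : V} :
    m.peek p (.prove x) = true ↔ x ∈ m.appended := by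
  simp [DenyMem.peek]

section DenyMem

variable {P V : Type} {managers verifiers : Finset P} {S : Set V} {m : ℕ → DenyMem P V}
  {H : History P (DenyOp V) (DenyResp P V)}

theorem validProves_succ (H : History P (DenyOp V) (DenyResp P V)) (t : ℕ) :
    validProves H (t + 1) = validProves H t ++ (validProve? (H t)).toList := by
  unfold validProves
  rw [List.range_succ, List.filterMap_append]
  cases h : validProve? (H t) <;> simp [h]

/-- The history `H` and the memory content `m` result from an interleaving of two-step
operations. -/
def IsDenyRun (managers verifiers : Finset P) (S : Set V) (m : ℕ → DenyMem P V)
    (H : History P (DenyOp V) (DenyResp P V)) : Prop :=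
  ∀ t, (H t = none ∧ m (t + 1) = m t) ∨ ∃ p op, ∃ t₀ ≤ t,
    (∀ u, t₀ ≤ u → u < t → ∀ e, H u = some e → e.proc ≠ p) ∧
    H t = some ⟨p, op, (DenyMem.apply managers verifiers S p op ((m t₀).peek p op) (m t)).2⟩ ∧
    m (t + 1) = (DenyMem.apply managers verifiers S p op ((m t₀).peek p op) (m t)).1

namespace IsDenyRun

/-- The operation that took place at time `t`, its peeking time, and its effect. -/
theorem of_event (h : IsDenyRun managers verifiers S m H) {t : ℕ} {p : P} {op : DenyOp V}
    {r : DenyResp P V} (ht : H t = some ⟨p, op, r⟩) : ∃ t₀ ≤ t,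
      (∀ u, t₀ ≤ u → u < t → ∀ e, H u = some e → e.proc ≠ p) ∧
      r = (DenyMem.apply managers verifiers S p op ((m t₀).peek p op) (m t)).2 ∧
      m (t + 1) = (DenyMem.apply managers verifiers S p op ((m t₀).peek p op) (m t)).1 := by
  rcases h t with ⟨h₁, -⟩ | ⟨p', op', t₀, ht₀, hno, h₁, h₂⟩
  · simp [ht] at h₁
  · simp only [ht, Option.some.injEq, Event.mk.injEq] at h₁
    obtain ⟨rfl, rfl, rfl⟩ := h₁
    exact ⟨t₀, ht₀, hno, rfl, h₂⟩

theorem monotone_appended (h : IsDenyRun managers verifiers S m H) :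
    Monotone fun t => (m t).appended := by
  refine monotone_nat_of_le_succ fun t => ?_
  rcases h t with ⟨-, h₂⟩ | ⟨p, op, t₀, -, -, -, h₂⟩
  · rw [h₂]
  · rw [h₂]
    cases op <;> simp only [DenyMem.apply] <;> (try split_ifs) <;> simp

theorem monotone_rejecting (h : IsDenyRun managers verifiers S m H) :
    Monotone fun t => (m t).rejecting := by
  refine monotone_nat_of_le_succ fun t => ?_
  rcases h t with ⟨-, h₂⟩ | ⟨p, op, t₀, -, -, -, h₂⟩
  · rw [h₂]
  · rw [h₂]
    cases op <;> simp only [DenyMem.apply] <;> (try split_ifs) <;> simp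

theorem rejecting_subset_appended (h : IsDenyRun managers verifiers S m H)
    (h₀ : m 0 = ⟨∅, ∅, 0⟩) (t : ℕ) : (m t).rejecting ⊆ (m t).appended := by
  induction t with
  | zero => simp [h₀]
  | succ t ih =>
    rcases h t with ⟨-, h₂⟩ | ⟨p, op, t₀, ht₀, -, -, h₂⟩
    · rwa [h₂]
    · rw [h₂]
      cases op with
      | append x =>
        simp only [DenyMem.apply]
        split_ifs with hx
        · exact ih.trans (Set.subset_insert _ _)
        · exact ih
      | prove x =>
        simp only [DenyMem.apply]
        split_ifs with hp hx
        · refine Set.insert_subset ?_ ih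
          exact hx.elim (fun hx => h.monotone_appended ht₀ (DenyMem.peek_prove.mp hx))
            (fun hx => ih hx)
        · exact ih
        · exact ih
      | read => exact ih

theorem exists_validAppend (h : IsDenyRun managers verifiers S m H)
    (h₀ : m 0 = ⟨∅, ∅, 0⟩) {t : ℕ} {x : V} (hx : x ∈ (m t).appended) :
    ∃ s < t, ValidAppend H s x := by
  induction t with
  | zero => simp [h₀] at hx
  | succ t ih =>
    by_cases hx' : x ∈ (m t).appended
    · obtain ⟨s, hs, hs'⟩ := ih hx'
      exact ⟨s, hs.trans (Nat.lt_succ_self t), hs'⟩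
    rcases h t with ⟨-, h₂⟩ | ⟨p, op, t₀, -, -, h₁, h₂⟩
    · rw [h₂] at hx
      exact absurd hx hx'
    · rw [h₂] at hx
      cases op with
      | append y =>
        simp only [DenyMem.apply] at hx h₁
        split_ifs at hx h₁ with hy
        · obtain rfl | hx := hx
          · exact ⟨t, Nat.lt_succ_self t, p, h₁⟩
          · exact absurd hx hx'
        · exact absurd hx hx'
      | prove y =>
        simp only [DenyMem.apply] at hx
        split_ifs at hx <;> exact absurd hx hx'
      | read => exact absurd hx hx'

theorem proofs_eq (h : IsDenyRun managers verifiers S m H) (h₀ : m 0 = ⟨∅, ∅, 0⟩) (t : ℕ) :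
    (m t).proofs = (validProves H t : Multiset (P × V)) := by
  induction t with
  | zero => simp [h₀, validProves]
  | succ t ih =>
    rw [validProves_succ]
    rcases h t with ⟨h₁, h₂⟩ | ⟨p, op, t₀, -, -, h₁, h₂⟩
    · simp [h₁, h₂, ih, validProve?]
    · rw [h₂, h₁, ← Multiset.coe_add, ← ih]
      cases op with
      | append y =>
        simp only [DenyMem.apply]
        split_ifs <;> simp [validProve?]
      | prove y =>
        simp only [DenyMem.apply]
        split_ifs
        · simp [validProve?]
        · simp [validProve?, ← Multiset.singleton_add, add_comm]
        · simp [validProve?]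
      | read => simp [DenyMem.apply, validProve?]

/-- After a valid APPEND, a PROVE is accepted only if its caller peeked before the APPEND, so that
each process has at most one such PROVE accepted. -/
theorem progress [Finite P] (h : IsDenyRun managers verifiers S m H) {s : ℕ} {x : V}
    (hs : ValidAppend H s x) : ∃ T, ∀ t ≥ T, ∀ p ∈ verifiers, ∀ r,
      H t = some ⟨p, .prove x, r⟩ → r = .reject := by
  have happ : x ∈ (m (s + 1)).appended := by
    obtain ⟨q, hq⟩ := hs
    obtain ⟨t₀, -, -, h₁, h₂⟩ := h.of_event hq
    rw [h₂]
    simp only [DenyMem.apply] at h₁ ⊢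
    split_ifs at h₁ ⊢
    simp
  have each : ∀ p, ∃ T, ∀ t ≥ T, p ∈ verifiers → ∀ r, H t = some ⟨p, .prove x, r⟩ →
      r = .reject := by
    intro p
    by_contra! hcon
    obtain ⟨t₁, ht₁, hp, r₁, hr₁, -⟩ := hcon (s + 1)
    obtain ⟨t₂, ht₂, -, r₂, hr₂, hne⟩ := hcon (t₁ + 1)
    obtain ⟨t₀, -, hno, hr, -⟩ := h.of_event hr₂
    simp only [DenyMem.apply, if_pos hp] at hr
    split_ifs at hr with h₂
    · exact hne hr
    · have ht₀ : t₀ ≤ t₁ := by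
        by_contra! hlt
        have hlt' : s + 1 ≤ t₀ := by omega
        exact h₂ (.inl (DenyMem.peek_prove.mpr (h.monotone_appended hlt' happ)))
      exact hno t₁ ht₀ (by omega) _ hr₁ rfl
  choose T hT using each
  obtain ⟨B, hB⟩ := (Set.finite_range T).bddAbove
  exact ⟨B, fun t ht p hp r hr => hT p t ((hB ⟨p, rfl⟩).trans ht) hp r hr⟩

theorem isDenyListHistory [Finite P] (h : IsDenyRun managers verifiers S m H)
    (h₀ : m 0 = ⟨∅, ∅, 0⟩) : IsDenyListHistory managers verifiers S H where
  append_validity t p x r ht := by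
    obtain ⟨t₀, -, -, hr, -⟩ := h.of_event ht
    simp only [DenyMem.apply] at hr
    split_ifs at hr with hx
    · exact .inl ⟨hr, hx⟩
    · exact .inr ⟨hr, hx⟩
  prove_response t p x r ht := by
    obtain ⟨t₀, -, -, hr, -⟩ := h.of_event ht
    simp only [DenyMem.apply] at hr
    split_ifs at hr
    · exact .inr hr
    · exact .inl hr
    · exact .inr hr
  prove_validity t p x hp ht := by
    obtain ⟨t₀, ht₀, -, hr, -⟩ := h.of_event ht
    refine h.exists_validAppend h₀ ?_
    simp only [DenyMem.apply, if_pos hp] at hr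
    split_ifs at hr with h₁
    exact h₁.elim (fun hx => h.monotone_appended ht₀ (DenyMem.peek_prove.mp hx))
      (fun hx => h.rejecting_subset_appended h₀ t hx)
  prove_authorized t p x r hp ht := by
    obtain ⟨t₀, -, -, hr, -⟩ := h.of_event ht
    simpa [DenyMem.apply, hp] using hr
  anti_flickering s t p q x r hst hp hs ht := by
    have hx : x ∈ (m (s + 1)).rejecting := by
      obtain ⟨t₀, -, -, hr, h₂⟩ := h.of_event hs
      rw [h₂]
      simp only [DenyMem.apply, if_pos hp] at hr ⊢
      split_ifs at hr ⊢
      simp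
    obtain ⟨t₀, -, -, hr, -⟩ := h.of_event ht
    have hx' : x ∈ (m t).rejecting := h.monotone_rejecting hst hx
    simpa [DenyMem.apply, hx'] using hr
  progress s x hs := h.progress hs
  read_validity t p r ht := by
    obtain ⟨t₀, -, -, hr, -⟩ := h.of_event ht
    refine ⟨_, hr, ?_⟩
    rw [← Multiset.coe_eq_coe, Multiset.coe_toList, h.proofs_eq h₀]

end IsDenyRun

/-- The APPENDs of a process that is not a verifier commute with the APPENDs and PROVEs of the
others and are not seen by READs, and its other operations do not change the memory. -/
theorem DenyMem.compatible_apply {r : P} (hr : r ∉ verifiers) (q : P) (op op' : DenyOp V)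
    (b b' : Bool) (m : DenyMem P V) :
    Compatible (DenyMem.apply managers verifiers S r op b)
      (DenyMem.apply managers verifiers S q op' b') m := by
  cases op with
  | append x =>
    by_cases hx : r ∈ managers ∧ x ∈ S
    · cases op' with
      | append y =>
        by_cases hy : q ∈ managers ∧ y ∈ S
        · left
          simp only [DenyMem.apply, if_pos hx, if_pos hy, Set.insert_comm, and_self]
        · apply Compatible.of_right
          simp only [DenyMem.apply, if_neg hy]
      | prove y =>
        left
        have happ : ∀ m : DenyMem P V, DenyMem.apply managers verifiers S r (.append x) b m =
            ({ m with appended := insert x m.appended }, .accept) :=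
          fun m => by simp only [DenyMem.apply, if_pos hx]
        rw [happ, happ]
        simp only [DenyMem.apply]
        split_ifs <;> simp
      | read => exact .of_right rfl
    · apply Compatible.of_left
      simp only [DenyMem.apply, if_neg hx]
  | prove x =>
    apply Compatible.of_left
    simp only [DenyMem.apply, if_neg hr]
  | read => exact .of_left rfl

/-- The DenyList is realized by a memory in which any process that is not a verifier is neutral. -/
noncomputable def denyListRealization [Finite P] (managers verifiers : Finset P) (S : Set V)
    (r : P) (hr : r ∉ verifiers) : Realization (denyList managers verifiers S) where
  Mem := DenyMem P V
  init := ⟨∅, ∅, 0⟩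
  peek := DenyMem.peek
  apply := DenyMem.apply managers verifiers S
  legal _ _ h₀ h := IsDenyRun.isDenyListHistory h h₀
  neutral := r
  compatible q _ := DenyMem.compatible_apply hr q

end DenyMem

/-! ### Runs of an algorithm on deterministic objects -/

namespace Algorithm

variable {n : ℕ} {Val : Type} (A : Algorithm n Val) (R : ∀ o, Realization (A.type o))

/-- The local state of each process, with the bit that it has obtained by peeking if it has started
an operation, and the content of each object. -/
structure Config where
  loc : Fin n → A.State × Option Bool
  mem : ∀ o, (R o).Mem

variable {A R}

namespace Config

open Classical in
/-- The atomic step of the process `p`. -/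
noncomputable def advance (C : A.Config R) (p : Fin n) : A.Config R :=
  match A.act p (C.loc p).1 with
  | .output _ => C
  | .invoke o op next =>
    let y := (R o).micro p op (C.loc p).2 (C.mem o)
    { loc := Function.update C.loc p
        (y.2.elim (fun b => ((C.loc p).1, some b)) (fun r => (next r, none)))
      mem := Function.update C.mem o y.1 }

open Classical in
/-- The operation performed on each object during the step of `p`: there is none if `p` peeks or has
decided. -/
noncomputable def events (C : A.Config R) (p : Fin n) :
    ∀ o, Option (Event (Fin n) (A.type o).Op (A.type o).Resp) :=
  match A.act p (C.loc p).1, (C.loc p).2 with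
  | .invoke o op _, some b =>
    Function.update (fun _ => none) o (some ⟨p, op, ((R o).apply p op b (C.mem o)).2⟩)
  | _, _ => fun _ => none

/-- The process `p`, unless its next step is to peek. -/
def mover (C : A.Config R) (p : Fin n) : Option (Fin n) :=
  match A.act p (C.loc p).1, (C.loc p).2 with
  | .invoke _ _ _, none => none
  | _, _ => some p

/-- The process `p` has decided `v`. -/
def HasDecided (C : A.Config R) (p : Fin n) (v : Val) : Prop :=
  A.act p (C.loc p).1 = .output v

/-- The configurations differ only in the local state of `p`. -/
def Like (p : Fin n) (C C' : A.Config R) : Prop :=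
  (∀ q, q ≠ p → C.loc q = C'.loc q) ∧ C.mem = C'.mem

variable {C C' : A.Config R} {p q : Fin n} {v w : Val}

theorem advance_of_output (h : A.act p (C.loc p).1 = .output v) : C.advance p = C := by
  rw [advance, h]

open Classical in
theorem advance_of_invoke {o op next} (h : A.act p (C.loc p).1 = .invoke o op next) :
    C.advance p =
      { loc := Function.update C.loc p (((R o).micro p op (C.loc p).2 (C.mem o)).2.elim
          (fun b => ((C.loc p).1, some b)) (fun r => (next r, none)))
        mem := Function.update C.mem o ((R o).micro p op (C.loc p).2 (C.mem o)).1 } := by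
  rw [advance, h]

theorem loc_advance_of_ne (h : q ≠ p) : (C.advance p).loc q = C.loc q := by
  cases hact : A.act p (C.loc p).1 with
  | output v => rw [advance_of_output hact]
  | invoke o op next => rw [advance_of_invoke hact]; simp [h]

theorem HasDecided.advance (h : C.HasDecided p v) (q : Fin n) : (C.advance q).HasDecided p v := by
  by_cases hpq : p = q
  · subst hpq; rwa [advance_of_output h]
  · rwa [HasDecided, loc_advance_of_ne hpq]

theorem Like.hasDecided (h : Like p C C') (hpq : p ≠ q) (hv : C.HasDecided q v) :
    C'.HasDecided q v := by
  rwa [HasDecided, ← h.1 q hpq.symm]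

theorem Like.advance (h : Like p C C') (hpq : p ≠ q) : Like p (C.advance q) (C'.advance q) := by
  have hq := h.1 q hpq.symm
  cases hact : A.act q (C.loc q).1 with
  | output v => rwa [advance_of_output hact, advance_of_output (hq ▸ hact)]
  | invoke o op next =>
    rw [advance_of_invoke hact, advance_of_invoke (hq ▸ hact), ← hq, ← h.2]
    refine ⟨fun r hr => ?_, rfl⟩
    by_cases hrq : r = q
    · subst hrq; simp
    · simpa [hrq] using h.1 r hr

/-- Compatibility of operations on one object carries over to configurations. -/
theorem stepsCompatible_of_compatible {o op op' next next'} (hpq : p ≠ q)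
    (hp : A.act p (C.loc p).1 = .invoke o op next) (hq : A.act q (C.loc q).1 = .invoke o op' next')
    (h : Compatible ((R o).micro p op (C.loc p).2) ((R o).micro q op' (C.loc q).2) (C.mem o)) :
    StepsCompatible advance Like C p q := by
  have hp' : A.act p ((C.advance q).loc p).1 = .invoke o op next := by
    rwa [loc_advance_of_ne hpq]
  have hq' : A.act q ((C.advance p).loc q).1 = .invoke o op' next' := by
    rwa [loc_advance_of_ne hpq.symm]
  have epq := advance_of_invoke hq'
  have eqp := advance_of_invoke hp'
  have ep := advance_of_invoke hp
  have eq := advance_of_invoke hq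
  rw [loc_advance_of_ne hpq.symm] at epq
  rw [loc_advance_of_ne hpq] at eqp
  have mp : (C.advance p).mem o = ((R o).micro p op (C.loc p).2 (C.mem o)).1 := by simp [ep]
  have mq : (C.advance q).mem o = ((R o).micro q op' (C.loc q).2 (C.mem o)).1 := by simp [eq]
  rw [mp] at epq
  rw [mq] at eqp
  rcases h with ⟨h₁, h₂, h₃⟩ | h | h
  · left
    rw [epq, eqp, h₁, h₂, h₃, ep, eq]
    simp only [Function.update_idem]
    rw [Function.update_comm hpq]
  · right; left
    rw [epq, h, ep, eq]
    refine ⟨fun r hr => ?_, by simp⟩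
    by_cases hrq : r = q
    · subst hrq; simp
    · simp [hrq, hr]
  · right; right
    rw [eqp, h, ep, eq]
    refine ⟨fun r hr => ?_, by simp⟩
    by_cases hrp : r = p
    · subst hrp; simp
    · simp [hrp, hr]

theorem advance_comm_of_ne {o o' op op' next next'} (hpq : p ≠ q) (ho : o ≠ o')
    (hp : A.act p (C.loc p).1 = .invoke o op next)
    (hq : A.act q (C.loc q).1 = .invoke o' op' next') :
    (C.advance p).advance q = (C.advance q).advance p := by
  classical
  have hp' : A.act p ((C.advance q).loc p).1 = .invoke o op next := by
    rwa [loc_advance_of_ne hpq]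
  have hq' : A.act q ((C.advance p).loc q).1 = .invoke o' op' next' := by
    rwa [loc_advance_of_ne hpq.symm]
  rw [advance_of_invoke hq', advance_of_invoke hp', loc_advance_of_ne hpq.symm,
    loc_advance_of_ne hpq]
  rw [advance_of_invoke hq, advance_of_invoke hp]
  simp only [Function.update_of_ne ho, Function.update_of_ne ho.symm]
  rw [Function.update_comm hpq, Function.update_comm ho]

/-- When no process has decided, steps on different objects commute, and for two steps on the same
object the neutral process of this object is compatible with both. -/
theorem exists_stepsCompatible (h : ∀ p v, ¬ C.HasDecided p v) (p q : Fin n) : ∃ r,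
    (r ≠ p → StepsCompatible advance Like C r p) ∧
      (r ≠ q → StepsCompatible advance Like C r q) := by
  have invokes : ∀ p, ∃ o op next, A.act p (C.loc p).1 = .invoke o op next := by
    intro p
    cases hact : A.act p (C.loc p).1 with
    | output v => exact absurd hact (h p v)
    | invoke o op next => exact ⟨o, op, next, rfl⟩
  obtain ⟨o, op, next, hp⟩ := invokes p
  obtain ⟨o', op', next', hq⟩ := invokes q
  by_cases ho : o = o'
  · subst ho
    obtain ⟨o'', op'', next'', hr⟩ := invokes (R o).neutral
    refine ⟨(R o).neutral, fun hne => ?_, fun hne => ?_⟩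
    all_goals
      by_cases ho : o'' = o
      · subst ho
        exact stepsCompatible_of_compatible hne hr (by assumption)
          ((R o'').compatible_micro hne.symm _ _ _ _ _)
      · exact .inl (advance_comm_of_ne hne ho hr (by assumption))
  · exact ⟨p, fun hne => absurd rfl hne, fun hne => .inl (advance_comm_of_ne hne ho hp hq)⟩

end Config
end Algorithm

/-! ### Runs as executions -/

namespace Algorithm

variable {n : ℕ} {Val : Type} (A : Algorithm n Val) (R : ∀ o, Realization (A.type o))

namespace Config

/-- The initial configuration. -/
def initial (input : Fin n → Val) : A.Config R where
  loc p := (A.init p (input p), none)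
  mem o := (R o).init

variable {A R}

/-- The configuration at each time when `τ` tells which process takes a step. -/
noncomputable def run (C : A.Config R) (τ : ℕ → Option (Fin n)) : ℕ → A.Config R
  | 0 => C
  | t + 1 => (τ t).elim (run C τ t) (run C τ t).advance

variable {C : A.Config R} {p q : Fin n} {v w : Val} {τ : ℕ → Option (Fin n)} {t : ℕ}

theorem run_succ_of_none (h : τ t = none) : C.run τ (t + 1) = C.run τ t := by
  rw [run, h, Option.elim_none]

theorem run_succ_of_some (h : τ t = some p) : C.run τ (t + 1) = (C.run τ t).advance p := by
  rw [run, h, Option.elim_some]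

theorem events_of_output (h : A.act p (C.loc p).1 = .output v) : C.events p = fun _ => none := by
  rw [events, h]

theorem events_of_peek (h : (C.loc p).2 = none) : C.events p = fun _ => none := by
  rw [events, h]
  cases A.act p (C.loc p).1 <;> rfl

open Classical in
theorem events_of_invoke {o op next b} (h : A.act p (C.loc p).1 = .invoke o op next)
    (hb : (C.loc p).2 = some b) : C.events p =
      Function.update (fun _ => none) o (some ⟨p, op, ((R o).apply p op b (C.mem o)).2⟩) := by
  rw [events, h, hb]

theorem mover_of_output (h : A.act p (C.loc p).1 = .output v) : C.mover p = some p := by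
  rw [mover, h]

theorem mover_of_peek {o op next} (h : A.act p (C.loc p).1 = .invoke o op next)
    (hb : (C.loc p).2 = none) : C.mover p = none := by
  rw [mover, h, hb]

theorem mover_of_some {b} (hb : (C.loc p).2 = some b) : C.mover p = some p := by
  rw [mover, hb]
  cases A.act p (C.loc p).1 <;> rfl

theorem proc_of_events {o e} (h : C.events p o = some e) : e.proc = p := by
  cases hact : A.act p (C.loc p).1 with
  | output v => simp [events_of_output hact] at h
  | invoke o' op next =>
    cases hb : (C.loc p).2 with
    | none => simp [events_of_peek hb] at h
    | some b =>
      rw [events_of_invoke hact hb] at h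
      by_cases ho : o = o'
      · subst ho
        simp only [Function.update_self, Option.some.injEq] at h
        rw [← h]
      · simp [ho] at h

/-- The history of each object in the run. -/
noncomputable def runHist (C : A.Config R) (τ : ℕ → Option (Fin n)) (o : A.Obj) :
    History (Fin n) (A.type o).Op (A.type o).Resp :=
  fun t => (τ t).bind fun p => (C.run τ t).events p o

/-- The bit held by a process was read from the object it is about to access, and it has not
performed any operation since. -/
theorem run_pending (input : Fin n → Val) (τ : ℕ → Option (Fin n)) (p : Fin n) {o op next b} (t : ℕ)
    (h : A.act p (((initial A R input).run τ t).loc p).1 = .invoke o op next)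
    (hb : (((initial A R input).run τ t).loc p).2 = some b) :
    ∃ t₀ ≤ t, (∀ u, t₀ ≤ u → u < t → ∀ e, (initial A R input).runHist τ o u = some e → e.proc ≠ p) ∧
      b = (R o).peek (((initial A R input).run τ t₀).mem o) p op := by
  induction t generalizing next b with
  | zero => simp [run, initial] at hb
  | succ t ih =>
    -- It is enough that step `t` leaves the local state of `p` alone and is not an operation of `p`.
    have keep : ((initial A R input).run τ (t + 1)).loc p = ((initial A R input).run τ t).loc p →
        (∀ e, (initial A R input).runHist τ o t = some e → e.proc ≠ p) →
        ∃ t₀ ≤ t + 1, (∀ u, t₀ ≤ u → u < t + 1 → ∀ e, (initial A R input).runHist τ o u = some e →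
          e.proc ≠ p) ∧ b = (R o).peek (((initial A R input).run τ t₀).mem o) p op := by
      intro hloc hev
      rw [hloc] at h hb
      obtain ⟨t₀, ht₀, hno, hpeek⟩ := ih h hb
      refine ⟨t₀, ht₀.trans (Nat.le_succ t), fun u hu hut e he => ?_, hpeek⟩
      rcases Nat.lt_succ_iff_lt_or_eq.mp hut with hut | rfl
      · exact hno u hu hut e he
      · exact hev e he
    cases hτ : τ t with
    | none =>
      refine keep (by rw [run_succ_of_none hτ]) fun e he => ?_
      simp [runHist, hτ] at he
    | some q =>
      by_cases hpq : p = q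
      · subst hpq
        cases hact : A.act p (((initial A R input).run τ t).loc p).1 with
        | output v =>
          refine keep (by rw [run_succ_of_some hτ, advance_of_output hact]) fun e he => ?_
          simp [runHist, hτ, events_of_output hact] at he
        | invoke o' op' next' =>
          rw [run_succ_of_some hτ, advance_of_invoke hact] at h hb
          cases hb' : (((initial A R input).run τ t).loc p).2 with
          | some b' =>
            simp [hb', Realization.micro] at hb
          | none =>
            simp only [hb', Realization.micro, Function.update_self, Sum.elim_inl] at h hb
            rw [hact] at h
            cases h
            refine ⟨t, Nat.le_succ t, fun u hu hut e he => ?_, (Option.some.inj hb).symm⟩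
            obtain rfl : u = t := by omega
            simp [runHist, hτ, events_of_peek hb'] at he
      · refine keep (by rw [run_succ_of_some hτ, loc_advance_of_ne hpq]) fun e he => ?_
        simp only [runHist, hτ, Option.bind_some] at he
        rw [proc_of_events he]
        exact Ne.symm hpq

theorem runHist_mem_spec (input : Fin n → Val) (τ : ℕ → Option (Fin n)) (o : A.Obj) :
    (initial A R input).runHist τ o ∈ (A.type o).spec := by
  refine (R o).legal (fun t => ((initial A R input).run τ t).mem o) _ rfl fun t => ?_
  cases hτ : τ t with
  | none =>
    left
    exact ⟨by simp [runHist, hτ], by rw [run_succ_of_none hτ]⟩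
  | some p =>
    simp only [runHist, hτ, Option.bind_some]
    rw [run_succ_of_some hτ]
    cases hact : A.act p (((initial A R input).run τ t).loc p).1 with
    | output v =>
      left
      exact ⟨by rw [events_of_output hact], by rw [advance_of_output hact]⟩
    | invoke o' op next =>
      by_cases ho : o = o'
      · subst ho
        cases hb : (((initial A R input).run τ t).loc p).2 with
        | none =>
          left
          exact ⟨by rw [events_of_peek hb],
            by rw [advance_of_invoke hact]; simp [hb, Realization.micro]⟩
        | some b =>
          right
          obtain ⟨t₀, ht₀, hno, rfl⟩ := run_pending input τ p t hact hb
          refine ⟨p, op, t₀, ht₀, hno, by rw [events_of_invoke hact hb]; simp, ?_⟩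
          rw [advance_of_invoke hact]
          simp [hb, Realization.micro]
      · left
        rw [advance_of_invoke hact]
        refine ⟨?_, by simp [ho]⟩
        cases hb : (((initial A R input).run τ t).loc p).2 with
        | none => rw [events_of_peek hb]
        | some b => rw [events_of_invoke hact hb]; simp [ho]

variable (A R) in
/-- A run from an initial configuration is an execution of the algorithm, in which nothing happens
at the times of peeking. -/
noncomputable def execution (input : Fin n → Val) (τ : ℕ → Option (Fin n)) :
    Execution A input where
  sched t := (τ t).bind ((initial A R input).run τ t).mover
  state t p := (((initial A R input).run τ t).loc p).1
  hist := (initial A R input).runHist τ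
  state_zero _ := rfl
  idle t h := by
    cases hτ : τ t with
    | none => exact ⟨by rw [run_succ_of_none hτ], fun o => by simp [runHist, hτ]⟩
    | some p =>
      simp only [hτ, Option.bind_some] at h
      cases hact : A.act p (((initial A R input).run τ t).loc p).1 with
      | output v => simp [mover_of_output hact] at h
      | invoke o op next =>
        cases hb : (((initial A R input).run τ t).loc p).2 with
        | some b => simp [mover_of_some hb] at h
        | none =>
          refine ⟨?_, fun o => by simp [runHist, hτ, events_of_peek hb]⟩
          funext q
          rw [run_succ_of_some hτ, advance_of_invoke hact]
          by_cases hq : q = p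
          · subst hq; simp [hb, Realization.micro]
          · simp [hq]
  halted t p v h hact := by
    cases hτ : τ t with
    | none => simp [hτ] at h
    | some q =>
      simp only [hτ, Option.bind_some] at h
      obtain rfl : q = p := by
        revert h
        rw [mover]
        split <;> simp
      exact ⟨by rw [run_succ_of_some hτ, advance_of_output hact],
        fun o => by simp [runHist, hτ, events_of_output hact]⟩
  step t p o op next h hact := by
    cases hτ : τ t with
    | none => simp [hτ] at h
    | some q =>
      simp only [hτ, Option.bind_some] at h
      obtain rfl : q = p := by
        revert h
        rw [mover]
        split <;> simp
      cases hb : (((initial A R input).run τ t).loc q).2 with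
      | none => simp [mover_of_peek hact hb] at h
      | some b =>
        simp only [runHist, hτ, Option.bind_some, events_of_invoke hact hb]
        classical
        refine ⟨⟨_, Function.update_self .., ?_⟩, fun o' ho' => by simp [ho']⟩
        rw [run_succ_of_some hτ, advance_of_invoke hact]
        funext q'
        by_cases hq : q' = q
        · subst hq; simp [hb, Realization.micro]
        · simp [hq]
  legal o := runHist_mem_spec input τ o

theorem run_loc_eq (C : A.Config R) {t t' : ℕ} (htt' : t ≤ t')
    (h : ∀ u, t ≤ u → u < t' → τ u ≠ some p) : (C.run τ t').loc p = (C.run τ t).loc p := by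
  induction t', htt' using Nat.le_induction with
  | base => rfl
  | succ t' htt' ih =>
    rw [← ih fun u hu hut => h u hu (hut.trans (Nat.lt_succ_self _))]
    cases hτ : τ t' with
    | none => rw [run_succ_of_none hτ]
    | some q =>
      rw [run_succ_of_some hτ, loc_advance_of_ne]
      rintro rfl
      exact h t' htt' (Nat.lt_succ_self _) hτ

/-- A process that takes infinitely many steps does not only peek. -/
theorem execution_sched (input : Fin n → Val) (hτ : ∀ s, ∃ t ≥ s, τ t = some p) (s : ℕ) :
    ∃ t ≥ s, (execution A R input τ).sched t = some p := by
  obtain ⟨t, hst, ht⟩ := hτ s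
  have hsched : ∀ t, τ t = some p →
      (execution A R input τ).sched t = ((initial A R input).run τ t).mover p := fun t ht => by
    simp [execution, ht]
  cases hact : A.act p (((initial A R input).run τ t).loc p).1 with
  | output v => exact ⟨t, hst, (hsched t ht).trans (mover_of_output hact)⟩
  | invoke o op next =>
    cases hb : (((initial A R input).run τ t).loc p).2 with
    | some b => exact ⟨t, hst, (hsched t ht).trans (mover_of_some hb)⟩
    | none =>
      have hex := hτ (t + 1)
      classical
      obtain ⟨htt', ht'⟩ := Nat.find_spec hex
      refine ⟨Nat.find hex, by omega, (hsched _ ht').trans ?_⟩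
      refine mover_of_some (b := (R o).peek (((initial A R input).run τ t).mem o) p op) ?_
      rw [run_loc_eq _ htt' fun u hu hut hup => Nat.find_min hex hut ⟨hu, hup⟩,
        run_succ_of_some ht, advance_of_invoke hact]
      simp [hb, Realization.micro]

/-- The runs from `C` are final parts of runs from an initial configuration. -/
def Reachable (C : A.Config R) : Prop :=
  ∃ input, ∀ τ, ∃ τ' t, ∀ u, τ' (t + u) = τ u ∧ (initial A R input).run τ' (t + u) = C.run τ u

theorem reachable_initial (input : Fin n → Val) : (initial A R input).Reachable :=
  ⟨input, fun τ => ⟨τ, 0, fun u => by simp⟩⟩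

theorem run_cons (C : A.Config R) (p : Fin n) (τ : ℕ → Option (Fin n)) (t : ℕ) :
    C.run (fun u => u.casesOn (some p) τ) (t + 1) = (C.advance p).run τ t := by
  induction t with
  | zero => rfl
  | succ t ih => rw [run, ih]; rfl

theorem Reachable.advance (h : C.Reachable) (p : Fin n) : (C.advance p).Reachable := by
  obtain ⟨input, h⟩ := h
  refine ⟨input, fun τ => ?_⟩
  obtain ⟨τ', t, ht⟩ := h (fun u => u.casesOn (some p) τ)
  refine ⟨τ', t + 1, fun u => ?_⟩
  rw [add_assoc, add_comm 1 u, (ht (u + 1)).1, (ht (u + 1)).2, run_cons]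
  exact ⟨rfl, rfl⟩

theorem run_some_eq {c : ℕ → A.Config R} {τ : ℕ → Fin n}
    (hc : ∀ t, c (t + 1) = (c t).advance (τ t)) (t : ℕ) : (c 0).run (fun t => some (τ t)) t = c t := by
  induction t with
  | zero => rfl
  | succ t ih => rw [run_succ_of_some rfl, ih, hc]

theorem exists_hasDecided (hA : A.SolvesConsensus) {c : ℕ → A.Config R} {τ : ℕ → Fin n}
    (h₀ : (c 0).Reachable) (hc : ∀ t, c (t + 1) = (c t).advance (τ t))
    (hp : ∀ s, ∃ t ≥ s, τ t = p) : ∃ t v, (c t).HasDecided p v := by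
  obtain ⟨input, h⟩ := h₀
  obtain ⟨τ', s, hs⟩ := h fun t => some (τ t)
  have hp' : ∀ u, ∃ t ≥ u, τ' t = some p := fun u => by
    obtain ⟨t, hut, ht⟩ := hp u
    exact ⟨s + t, by omega, by rw [(hs t).1, ht]⟩
  obtain ⟨v, t, -, hv⟩ := hA.termination input (execution A R input τ') p (execution_sched input hp')
  have hv : ((initial A R input).run τ' t).HasDecided p v := hv
  have hv' : ((initial A R input).run τ' (s + t)).HasDecided p v := by
    clear hs
    induction s with
    | zero => simpa using hv
    | succ s ih =>
      rw [Nat.succ_add]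
      cases hτ : τ' (s + t) with
      | none => rwa [run_succ_of_none hτ]
      | some q => rw [run_succ_of_some hτ]; exact ih.advance q
  rw [(hs t).2, run_some_eq hc] at hv'
  exact ⟨t, v, hv'⟩

theorem hasDecided_unique (hA : A.SolvesConsensus) (hC : C.Reachable) (hv : C.HasDecided p v)
    (hw : C.HasDecided q w) : v = w := by
  obtain ⟨input, h⟩ := hC
  -- Both processes take an idle step, so that they have certainly started.
  let τ : ℕ → Option (Fin n) := fun | 0 => some p | 1 => some q | _ => none
  obtain ⟨τ', s, hs⟩ := h τ
  have h₀ : (initial A R input).run τ' s = C := (hs 0).2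
  have h₁ : (initial A R input).run τ' (s + 1) = C :=
    (hs 1).2.trans ((run_succ_of_some (p := p) rfl).trans (advance_of_output hv))
  have h₂ : (initial A R input).run τ' (s + 2) = C := by
    have h₁' : C.run τ 1 = C := (hs 1).2.symm.trans h₁
    rw [(hs 2).2, run_succ_of_some (p := q) rfl, h₁', advance_of_output hw]
  have hps : (execution A R input τ').sched s = some p := by
    have := (hs 0).1
    simp only [add_zero] at this
    simp only [execution, this, τ, Option.bind_some, h₀]
    exact mover_of_output hv
  have hqs : (execution A R input τ').sched (s + 1) = some q := by
    simp only [execution, (hs 1).1, τ, Option.bind_some, h₁]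
    exact mover_of_output hw
  refine hA.agreement input (execution A R input τ') p q v w (s + 2) (s + 2)
    ⟨⟨s, by omega, hps⟩, ?_⟩ ⟨⟨s + 1, by omega, hqs⟩, ?_⟩
  · simp only [execution, h₂]; exact hv
  · simp only [execution, h₂]; exact hw

/-- By validity, a process that runs alone decides its own input. -/
theorem reaches_input (hA : A.SolvesConsensus) (input : Fin n → Val) (p : Fin n) :
    Reaches advance HasDecided (initial A R input) (input p) := by
  obtain ⟨v, t, hv⟩ := hA.termination input (execution A R input fun _ => some p) p
    (execution_sched input fun s => ⟨s, le_rfl, rfl⟩)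
  obtain ⟨q, ⟨s, -, hs⟩, rfl⟩ := hA.validity input _ p v t hv
  obtain rfl : p = q := by
    simp only [execution, Option.bind_some] at hs
    revert hs
    rw [mover]
    split <;> simp
  exact reaches_of_solo (c := (initial A R input).run fun _ => some p)
    (fun t => run_succ_of_some rfl) hv.2

end Config

/-- No algorithm for two or more processes solves consensus if each object that it uses has a
deterministic realization. -/
theorem not_solvesConsensus_of_realization [Nontrivial Val] (R : ∀ o, Realization (A.type o))
    (hn : 2 ≤ n) : ¬ A.SolvesConsensus := by
  intro hA
  obtain ⟨a, b, hab⟩ := exists_pair_ne Val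
  let p : Fin n := ⟨0, by omega⟩
  let q : Fin n := ⟨1, by omega⟩
  let input : Fin n → Val := fun i => if i = p then a else b
  refine not_bivalent (step := Config.advance) (decided := Config.HasDecided) Config.Like
    (Config.Reachable (A := A) (R := R))
    (fun C p h => h.advance p) (fun C p q v h => h.advance q)
    (fun C p q v w hC hv hw => Config.hasDecided_unique hA hC hv hw)
    (fun c τ p h₀ hc hp => Config.exists_hasDecided hA h₀ hc hp)
    (fun p q C C' hpq h => h.advance hpq) (fun p q C C' v hpq h hv => h.hasDecided hpq hv)
    (fun C _ h p q => Config.exists_stepsCompatible h p q)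
    (Config.initial A R input) (Config.reachable_initial input) ?_
  have hp : input p = a := if_pos rfl
  have hq : input q = b := if_neg (by simp [p, q])
  exact ⟨a, b, hab, hp ▸ Config.reaches_input hA input p, hq ▸ Config.reaches_input hA input q⟩

end Algorithm

/-- In a system of more than `k` processes, each DenyList with `k` verifiers has a process that is
not a verifier, hence a deterministic realization. -/
theorem not_consensusSolvable_kDenyList {V : Type} (S : Set V) {Val : Type} [Nontrivial Val]
    {k n : ℕ} (hk : 1 ≤ k) (hkn : k < n) : ¬ ConsensusSolvable (kDenyList S k) Val n := by
  rintro ⟨A, hobj, hA⟩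
  have hR : ∀ o, Nonempty (Realization (A.type o)) := by
    intro o
    rcases hobj o with ⟨managers, verifiers, hcard, h⟩ | ⟨B, b, h⟩
    · obtain ⟨r, hr⟩ : ∃ r, r ∉ verifiers := by
        by_contra! hall
        have := Finset.card_fin n ▸ congrArg Finset.card (Finset.eq_univ_of_forall hall)
        omega
      rw [h]
      exact ⟨denyListRealization managers verifiers S r hr⟩
    · rw [h]
      exact ⟨registerRealization b ⟨0, by omega⟩⟩
  exact A.not_solvesConsensus_of_realization (fun o => (hR o).some) (by omega) hA

/-! ### Consensus among the verifiers of a DenyList -/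

/-- The smallest process that appears in a list of proofs. -/
noncomputable def winner? {n : ℕ} {V : Type} (l : List (Fin n × V)) : Option (Fin n) :=
  if h : (l.map Prod.fst).toFinset.Nonempty then some ((l.map Prod.fst).toFinset.min' h) else none

theorem winner?_eq_of_perm {n : ℕ} {V : Type} {l l' : List (Fin n × V)} (h : l.Perm l') :
    winner? l = winner? l' := by
  have := List.toFinset_eq_of_perm _ _ (h.map Prod.fst)
  simp only [winner?, this]

theorem exists_winner?_eq {n : ℕ} {V : Type} {l : List (Fin n × V)} (h : l ≠ []) :
    ∃ j, winner? l = some j := by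
  refine ⟨_, dif_pos ?_⟩
  rw [List.toFinset_nonempty_iff]
  simpa using h

theorem exists_mem_of_winner?_eq {n : ℕ} {V : Type} {l : List (Fin n × V)} {j : Fin n}
    (h : winner? l = some j) : ∃ x, (j, x) ∈ l := by
  unfold winner? at h
  split_ifs at h with hne
  obtain rfl := Option.some.inj h
  simpa using Finset.min'_mem _ hne

/-- What a process taking part in `verifierConsensus` is about to do. -/
inductive Phase (n : ℕ) (Val : Type) where
  | announce (v : Val)
  | prove
  | append
  | retry
  | collect
  | fetch (j : Fin n)
  | done (v : Val)

/-- A consensus algorithm in which every process is a manager and a verifier of one DenyList. Each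
process announces its input in its own register, tries to PROVE `x`, APPENDs `x`, repeats the PROVE
until it is rejected, and decides the input of the smallest process with a valid PROVE. -/
noncomputable def verifierConsensus {V : Type} (S : Set V) (x : V) (n : ℕ) (Val : Type) :
    Algorithm n Val where
  Obj := Option (Fin n)
  type
    | none => denyList Finset.univ Finset.univ S
    | some _ => register (Fin n) (Option Val) none
  State := Phase n Val
  init _ v := .announce v
  act p
    | .announce v => .invoke (some p) (RegOp.write (some v)) fun _ => .prove
    | .prove => .invoke none (DenyOp.prove x) fun _ => .append
    | .append => .invoke none (DenyOp.append x) fun _ => .retry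
    | .retry => .invoke none (DenyOp.prove x) fun
      | DenyResp.reject => .collect
      | _ => .retry
    | .collect => .invoke none DenyOp.read fun
      | DenyResp.proofs l => (winner? l).elim .collect .fetch
      | _ => .collect
    | .fetch j => .invoke (some j) RegOp.read fun
      | RegResp.value (some v) => .done v
      | _ => .fetch j
    | .done v => .output v

namespace verifierConsensus

variable {V : Type} {S : Set V} {x : V} {n : ℕ} {Val : Type} {input : Fin n → Val}
  (E : Execution (verifierConsensus S x n Val) input)

/-- The phase of the process `p` at time `t`. -/
def phase (t : ℕ) (p : Fin n) : Phase n Val := E.state t p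

/-- The history of the DenyList. -/
def deny : History (Fin n) (DenyOp V) (DenyResp (Fin n) V) := E.hist none

/-- The history of the register of the process `i`. -/
def reg (i : Fin n) : History (Fin n) (RegOp (Option Val)) (RegResp (Option Val)) :=
  E.hist (some i)

/-- What can happen at time `t`: nothing, an operation of `p` on the DenyList, or an operation of `p`
on the register of `i`, together with its effect on the phase of `p`. -/
inductive Move (t : ℕ) : Prop
  | idle (hphase : phase E (t + 1) = phase E t) (hdeny : deny E t = none)
      (hreg : ∀ i, reg E i t = none)
  | deny (p : Fin n) (op : DenyOp V) (r : DenyResp (Fin n) V) (ph : Phase n Val)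
      (hsched : E.sched t = some p) (hdeny : deny E t = some ⟨p, op, r⟩)
      (hreg : ∀ i, reg E i t = none) (hphase : phase E (t + 1) = Function.update (phase E t) p ph)
      (h : (phase E t p = .prove ∧ op = .prove x ∧ ph = .append) ∨
        (phase E t p = .append ∧ op = .append x ∧ ph = .retry) ∨
        (phase E t p = .retry ∧ op = .prove x ∧ (r = .reject ∧ ph = .collect ∨ ph = .retry)) ∨
        (phase E t p = .collect ∧ op = .read ∧
          ((∃ l j, r = .proofs l ∧ winner? l = some j ∧ ph = .fetch j) ∨ ph = .collect)))
  | reg (p i : Fin n) (op : RegOp (Option Val)) (r : RegResp (Option Val)) (ph : Phase n Val)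
      (hsched : E.sched t = some p) (hdeny : deny E t = none) (hreg : reg E i t = some ⟨p, op, r⟩)
      (hreg' : ∀ j, j ≠ i → reg E j t = none)
      (hphase : phase E (t + 1) = Function.update (phase E t) p ph)
      (h : (∃ v, phase E t p = .announce v ∧ i = p ∧ op = .write (some v) ∧ ph = .prove) ∨
        (phase E t p = .fetch i ∧ op = .read ∧
          ((∃ v, r = .value (some v) ∧ ph = .done v) ∨ ph = .fetch i)))

theorem move (t : ℕ) : Move E t := by
  have step := E.step t
  cases hs : E.sched t with
  | none =>
    obtain ⟨h₁, h₂⟩ := E.idle t hs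
    exact .idle h₁ (h₂ none) fun i => h₂ (some i)
  | some p =>
    have step := fun o op next => step p o op next hs
    cases hp : phase E t p with
    | announce v =>
      obtain ⟨⟨r, h₁, h₂⟩, h₃⟩ := step (some p) (RegOp.write (some v)) (fun _ => .prove)
        (congrArg ((verifierConsensus S x n Val).act p) hp)
      exact .reg p p _ r _ hs (h₃ none (Option.some_ne_none _).symm) h₁
        (fun j hj => h₃ (some j) fun h => hj (Option.some.inj h)) h₂
        (.inl ⟨v, hp, rfl, rfl, rfl⟩)
    | prove =>
      obtain ⟨⟨r, h₁, h₂⟩, h₃⟩ := step none (DenyOp.prove x) _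
        (congrArg ((verifierConsensus S x n Val).act p) hp)
      exact .deny p _ r _ hs h₁ (fun j => h₃ (some j) (Option.some_ne_none j)) h₂ (.inl ⟨hp, rfl, rfl⟩)
    | append =>
      obtain ⟨⟨r, h₁, h₂⟩, h₃⟩ := step none (DenyOp.append x) _
        (congrArg ((verifierConsensus S x n Val).act p) hp)
      exact .deny p _ r _ hs h₁ (fun j => h₃ (some j) (Option.some_ne_none j)) h₂ (.inr (.inl ⟨hp, rfl, rfl⟩))
    | retry =>
      obtain ⟨⟨r, h₁, h₂⟩, h₃⟩ := step none (DenyOp.prove x) _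
        (congrArg ((verifierConsensus S x n Val).act p) hp)
      refine .deny p _ r _ hs h₁ (fun j => h₃ (some j) (Option.some_ne_none j)) h₂
        (.inr (.inr (.inl ⟨hp, rfl, ?_⟩)))
      cases r with
      | reject => exact .inl ⟨rfl, rfl⟩
      | accept => exact .inr rfl
      | proofs l => exact .inr rfl
    | collect =>
      obtain ⟨⟨r, h₁, h₂⟩, h₃⟩ := step none DenyOp.read _
        (congrArg ((verifierConsensus S x n Val).act p) hp)
      refine .deny p _ r _ hs h₁ (fun j => h₃ (some j) (Option.some_ne_none j)) h₂
        (.inr (.inr (.inr ⟨hp, rfl, ?_⟩)))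
      cases r with
      | reject => exact .inr rfl
      | accept => exact .inr rfl
      | proofs l =>
        cases hw : winner? l with
        | none => right; simp [hw]
        | some j => left; exact ⟨l, j, rfl, hw, by simp [hw]⟩
    | fetch j =>
      obtain ⟨⟨r, h₁, h₂⟩, h₃⟩ := step (some j) RegOp.read _
        (congrArg ((verifierConsensus S x n Val).act p) hp)
      refine .reg p j _ r _ hs (h₃ none (Option.some_ne_none _).symm) h₁
        (fun i hi => h₃ (some i) fun h => hi (Option.some.inj h)) h₂ (.inr ⟨hp, rfl, ?_⟩)
      cases r with
      | ack => exact .inr rfl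
      | value a =>
        cases a with
        | none => exact .inr rfl
        | some v => exact .inl ⟨v, rfl, rfl⟩
    | done v =>
      obtain ⟨h₁, h₂⟩ := E.halted t p v hs (congrArg ((verifierConsensus S x n Val).act p) hp)
      exact .idle h₁ (h₂ none) fun i => h₂ (some i)

theorem deny_legal : IsDenyListHistory Finset.univ Finset.univ S (deny E) := E.legal none

/-- A process in the phase `announce` has not written its register, and any other process has
written its input there. -/
theorem exists_content : ∃ content : Fin n → ℕ → Option Val,
    (∀ i t, RegStep (content i t) (content i (t + 1)) (reg E i t)) ∧
    ∀ i t, (phase E t i = .announce (input i) ∧ content i t = none) ∨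
      ((∀ v, phase E t i ≠ .announce v) ∧ content i t = some (input i) ∧ E.Started i t) := by
  have hlegal : ∀ i, ∃ content : ℕ → Option Val, content 0 = none ∧
      ∀ t, RegStep (content t) (content (t + 1)) (reg E i t) := fun i => E.legal (some i)
  choose content h₀ hstep using hlegal
  refine ⟨content, hstep, fun i t => ?_⟩
  induction t with
  | zero => exact .inl ⟨E.state_zero i, h₀ i⟩
  | succ t ih =>
    have keep : phase E (t + 1) i = phase E t i → content i (t + 1) = content i t →
        (phase E (t + 1) i = .announce (input i) ∧ content i (t + 1) = none) ∨
        ((∀ v, phase E (t + 1) i ≠ .announce v) ∧ content i (t + 1) = some (input i) ∧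
          E.Started i (t + 1)) := by
      intro h₁ h₂
      rw [h₁, h₂]
      exact ih.imp_right fun ⟨h₃, h₄, s, hs, h₅⟩ => ⟨h₃, h₄, s, hs.trans (Nat.lt_succ_self t), h₅⟩
    have changed : content i (t + 1) = content i t → (∀ v, phase E t i ≠ .announce v) →
        (∀ v, phase E (t + 1) i ≠ .announce v) →
        (phase E (t + 1) i = .announce (input i) ∧ content i (t + 1) = none) ∨
        ((∀ v, phase E (t + 1) i ≠ .announce v) ∧ content i (t + 1) = some (input i) ∧
          E.Started i (t + 1)) := by
      intro h₁ h₂ h₃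
      rcases ih with ih | ⟨-, h₄, s, hs, h₅⟩
      · exact absurd ih.1 (h₂ _)
      · exact .inr ⟨h₃, h₁.trans h₄, s, hs.trans (Nat.lt_succ_self t), h₅⟩
    have hi := hstep i t
    cases move E t with
    | idle hphase _ hreg =>
      rw [hreg] at hi
      exact keep (by rw [hphase]) hi
    | deny p op r ph hsched _ hreg hphase h =>
      rw [hreg] at hi
      by_cases hip : i = p
      · subst hip
        refine changed hi (fun v hv => by simp [hv] at h) fun v hv => ?_
        simp only [hphase, Function.update_self] at hv
        subst hv
        simp at h
      · exact keep (by rw [hphase, Function.update_of_ne hip]) hi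
    | reg p j op r ph hsched _ hreg hreg' hphase h =>
      rcases h with ⟨v, hp, rfl, rfl, rfl⟩ | ⟨hp, rfl, h⟩
      · by_cases hij : i = j
        · subst hij
          right
          rw [hreg] at hi
          refine ⟨fun v => by simp [hphase], ?_, t, Nat.lt_succ_self t, hsched⟩
          rcases ih with ih | ih
          · rw [hp] at ih
            cases ih.1
            exact hi.2
          · exact absurd hp (ih.1 v)
        · rw [hreg' i hij] at hi
          exact keep (by rw [hphase, Function.update_of_ne hij]) hi
      · have hi' : content i (t + 1) = content i t := by
          by_cases hij : i = j
          · subst hij; rw [hreg] at hi; exact hi.2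
          · rw [hreg' i hij] at hi; exact hi
        by_cases hip : i = p
        · subst hip
          refine changed hi' (fun v hv => by simp [hv] at hp) fun v hv => ?_
          simp only [hphase, Function.update_self] at hv
          subst hv
          simp at h
        · exact keep (by rw [hphase, Function.update_of_ne hip]) hi'

/-- A process that accesses the DenyList has announced its input, and it proves only `x`. -/
theorem phase_of_deny_eq {t : ℕ} {e} (h : deny E t = some e) :
    (∀ v, phase E t e.proc ≠ .announce v) ∧ (∀ y, e.op = .prove y → y = x) ∧
      (∀ y, e.op = .append y → phase E t e.proc = .append) := by
  cases move E t with
  | idle _ hdeny => simp [hdeny] at h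
  | reg _ _ _ _ _ _ hdeny => simp [hdeny] at h
  | deny p op r ph _ hdeny _ _ hcase =>
    rw [hdeny] at h
    obtain rfl := Option.some.inj h
    rcases hcase with ⟨hp, rfl, -⟩ | ⟨hp, rfl, -⟩ | ⟨hp, rfl, -⟩ | ⟨hp, rfl, -⟩ <;>
      simp_all

theorem phase_ne_announce_mono {s t : ℕ} (hst : s ≤ t) {i : Fin n}
    (h : ∀ v, phase E s i ≠ .announce v) (v : Val) : phase E t i ≠ .announce v := by
  induction t, hst using Nat.le_induction generalizing v with
  | base => exact h v
  | succ t _ ih =>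
    cases move E t with
    | idle hphase => rw [hphase]; exact ih v
    | deny p op r ph _ _ _ hphase hcase =>
      rw [hphase]
      by_cases hip : i = p
      · subst hip
        rw [Function.update_self]
        rintro rfl
        simp at hcase
      · rw [Function.update_of_ne hip]; exact ih v
    | reg p j op r ph _ _ _ _ hphase hcase =>
      rw [hphase]
      by_cases hip : i = p
      · subst hip
        rw [Function.update_self]
        rintro rfl
        simp at hcase
      · rw [Function.update_of_ne hip]; exact ih v

/-- The winner has announced its input, since it has accessed the DenyList. -/
theorem phase_winner_ne_announce {t : ℕ} {j : Fin n}
    (h : winner? (validProves (deny E) t) = some j) (v : Val) : phase E t j ≠ .announce v := by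
  obtain ⟨y, hy⟩ := exists_mem_of_winner?_eq h
  simp only [validProves, List.mem_filterMap, List.mem_range] at hy
  obtain ⟨s, hst, hs⟩ := hy
  refine phase_ne_announce_mono E hst.le (fun v => ?_) v
  rcases hev : deny E s with _ | ⟨p, op, r⟩
  · simp [hev, validProve?] at hs
  · have := (phase_of_deny_eq E hev).1 v
    rw [hev] at hs
    cases op <;> cases r <;> simp only [validProve?, reduceCtorEq, Option.some.injEq,
      Prod.mk.injEq] at hs
    rwa [hs.1] at this

/-- A PROVE has been rejected before time `t`. -/
def Frozen (t : ℕ) : Prop := ∃ s < t, ∃ q, deny E s = some ⟨q, .prove x, .reject⟩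

theorem validProves_succ_eq_append (t : ℕ) : ∃ l,
    validProves (deny E) (t + 1) = validProves (deny E) t ++ l := ⟨_, validProves_succ _ _⟩

/-- By anti-flickering, the valid PROVEs do not change once a PROVE has been rejected. -/
theorem validProves_succ_eq_of_frozen {t : ℕ} (h : Frozen E t) :
    validProves (deny E) (t + 1) = validProves (deny E) t := by
  obtain ⟨s, hst, q, hs⟩ := h
  rw [validProves_succ]
  rcases hev : deny E t with _ | ⟨p, op, r⟩
  · simp [validProve?]
  · cases op with
    | append y => simp [validProve?]
    | read => simp [validProve?]
    | prove y =>
      obtain rfl : y = x := (phase_of_deny_eq E hev).2.1 y rfl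
      obtain rfl := (deny_legal E).anti_flickering s t q p y r hst (Finset.mem_univ q) hs hev
      simp [validProve?]

/-- What a process in the given phase at time `t` may rely on. -/
def PhaseInv (t : ℕ) : Phase n Val → Prop
  | .announce _ | .prove => True
  | .append | .retry => validProves (deny E) t ≠ []
  | .collect => Frozen E t ∧ validProves (deny E) t ≠ []
  | .fetch j => Frozen E t ∧ winner? (validProves (deny E) t) = some j
  | .done v => Frozen E t ∧ ∃ j, winner? (validProves (deny E) t) = some j ∧ input j = v

variable {E}

theorem PhaseInv.mono {s t : ℕ} (hst : s ≤ t) {ph : Phase n Val} (h : PhaseInv E s ph) :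
    PhaseInv E t ph := by
  induction t, hst using Nat.le_induction with
  | base => exact h
  | succ t _ ih =>
    have hne : validProves (deny E) t ≠ [] → validProves (deny E) (t + 1) ≠ [] := fun h => by
      obtain ⟨l, hl⟩ := validProves_succ_eq_append E t
      simp [hl, h]
    have hfr : Frozen E t → Frozen E (t + 1) := fun ⟨s, hs, h⟩ => ⟨s, hs.trans (Nat.lt_succ_self t), h⟩
    cases ph with
    | announce v => trivial
    | prove => trivial
    | append => exact hne ih
    | retry => exact hne ih
    | collect => exact ⟨hfr ih.1, hne ih.2⟩
    | fetch j => exact ⟨hfr ih.1, by rw [validProves_succ_eq_of_frozen E ih.1]; exact ih.2⟩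
    | done v => exact ⟨hfr ih.1, by rw [validProves_succ_eq_of_frozen E ih.1]; exact ih.2⟩

variable (E)

theorem phaseInv (t : ℕ) : ∀ p, PhaseInv E t (phase E t p) := by
  induction t using Nat.strong_induction_on with
  | _ t ih =>
  intro q
  rcases t with _ | t
  · have : phase E 0 q = .announce (input q) := E.state_zero q
    rw [this]; trivial
  have ihq := ih t (Nat.lt_succ_self t)
  have keep : phase E (t + 1) q = phase E t q → PhaseInv E (t + 1) (phase E (t + 1) q) := by
    intro h
    rw [h]
    exact (ihq q).mono (Nat.le_succ t)
  cases move E t with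
  | idle hphase => exact keep (by rw [hphase])
  | deny p op r ph _ hdeny _ hphase h =>
    by_cases hqp : q = p
    swap
    · exact keep (by rw [hphase, Function.update_of_ne hqp])
    subst hqp
    have ihq := ihq q
    rcases h with ⟨hp, rfl, rfl⟩ | ⟨hp, rfl, rfl⟩ | ⟨hp, rfl, h⟩ | ⟨hp, rfl, h⟩ <;>
      rw [hphase, Function.update_self] <;> rw [hp] at ihq
    · -- The PROVE is valid, or follows an APPEND, whose caller was sure that there is a valid PROVE.
      rcases (deny_legal E).prove_response _ _ _ _ hdeny with rfl | rfl
      · change validProves (deny E) (t + 1) ≠ []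
        simp [validProves_succ, hdeny, validProve?]
      · obtain ⟨s, hst, q', hs⟩ := (deny_legal E).prove_validity t q x (Finset.mem_univ q) hdeny
        have := ih s (by omega) q'
        rw [(phase_of_deny_eq E hs).2.2 x rfl] at this
        exact this.mono (by omega)
    · exact ihq.mono (Nat.le_succ t)
    · have hr : PhaseInv E (t + 1) .retry := ihq.mono (Nat.le_succ t)
      rcases h with ⟨rfl, rfl⟩ | rfl
      · exact ⟨⟨t, Nat.lt_succ_self t, q, hdeny⟩, hr⟩
      · exact hr
    · have hc : PhaseInv E (t + 1) .collect := ihq.mono (Nat.le_succ t)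
      rcases h with ⟨l, j, rfl, hl, rfl⟩ | rfl
      · refine ⟨hc.1, ?_⟩
        obtain ⟨l', hl', hperm⟩ := (deny_legal E).read_validity _ _ _ hdeny
        cases hl'
        rw [validProves_succ_eq_of_frozen E ihq.1, ← winner?_eq_of_perm hperm, hl]
      · exact hc
  | reg p i op r ph _ _ hreg _ hphase h =>
    by_cases hqp : q = p
    swap
    · exact keep (by rw [hphase, Function.update_of_ne hqp])
    subst hqp
    have ihq := ihq q
    rcases h with ⟨v, hp, rfl, rfl, rfl⟩ | ⟨hp, rfl, h⟩ <;>
      rw [hphase, Function.update_self] <;> rw [hp] at ihq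
    · trivial
    · have hf : PhaseInv E (t + 1) (.fetch i) := ihq.mono (Nat.le_succ t)
      rcases h with ⟨v, rfl, rfl⟩ | rfl
      · refine ⟨hf.1, i, hf.2, ?_⟩
        obtain ⟨content, hstep, hcontent⟩ := exists_content E
        have hi := hstep i t
        rw [hreg] at hi
        obtain ⟨-, hi', -⟩ := (hcontent i t).resolve_left
          fun h => phase_winner_ne_announce E ihq.2 _ h.1
        simpa [hi'] using hi.1.symm
      · exact hf

/-! ### Correctness of the algorithm -/

theorem phase_of_decides {p : Fin n} {v : Val} {t : ℕ} (h : E.Decides p v t) :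
    phase E t p = .done v := by
  have hact : (verifierConsensus S x n Val).act p (phase E t p) = .output v := h.2
  cases hp : phase E t p with
  | done w =>
    rw [hp] at hact
    cases hact
    rfl
  | _ => rw [hp] at hact; cases hact

theorem validity {p : Fin n} {v : Val} {t : ℕ} (h : E.Decides p v t) :
    ∃ q, E.Started q t ∧ input q = v := by
  have hinv := phaseInv E t p
  rw [phase_of_decides E h] at hinv
  obtain ⟨-, j, hj, hv⟩ := hinv
  obtain ⟨content, -, hcontent⟩ := exists_content E
  exact ⟨j, ((hcontent j t).resolve_left
    fun h => phase_winner_ne_announce E hj _ h.1).2.2, hv⟩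

theorem agreement {p q : Fin n} {v w : Val} {s t : ℕ} (hv : E.Decides p v s)
    (hw : E.Decides q w t) : v = w := by
  have hp := phaseInv E s p
  have hq := phaseInv E t q
  rw [phase_of_decides E hv] at hp
  rw [phase_of_decides E hw] at hq
  obtain ⟨-, i, hi, rfl⟩ := hp.mono (le_max_left s t)
  obtain ⟨-, j, hj, rfl⟩ := hq.mono (le_max_right s t)
  rw [hi] at hj
  rw [Option.some.inj hj]

theorem phase_succ_of_not_scheduled {t : ℕ} {p : Fin n} (h : E.sched t ≠ some p) :
    phase E (t + 1) p = phase E t p := by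
  cases move E t with
  | idle hphase => rw [hphase]
  | deny q op r ph hsched _ _ hphase =>
    rw [hphase, Function.update_of_ne]
    rintro rfl
    exact h hsched
  | reg q i op r ph hsched _ _ _ hphase =>
    rw [hphase, Function.update_of_ne]
    rintro rfl
    exact h hsched

theorem exists_scheduled {p : Fin n} (hp : ∀ s, ∃ t ≥ s, E.sched t = some p) (s : ℕ) :
    ∃ t ≥ s, E.sched t = some p ∧ phase E t p = phase E s p := by
  classical
  have hex := hp s
  obtain ⟨hst, ht⟩ := Nat.find_spec hex
  refine ⟨Nat.find hex, hst, ht, ?_⟩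
  have key : ∀ u, s ≤ u → u ≤ Nat.find hex → phase E u p = phase E s p := by
    intro u hu
    induction u, hu using Nat.le_induction with
    | base => exact fun _ => rfl
    | succ u hu ih =>
      intro hut
      rw [phase_succ_of_not_scheduled E fun h => Nat.find_min hex hut ⟨hu, h⟩]
      exact ih (by omega)
  exact key _ hst le_rfl

theorem termination (hx : x ∈ S) {p : Fin n} (hp : ∀ s, ∃ t ≥ s, E.sched t = some p) :
    ∃ v t, E.Decides p v t := by
  have step := fun t o op next => E.step t p o op next
  have next := exists_scheduled E hp
  have h₁ : ∃ t, phase E t p = .prove := by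
    obtain ⟨t, -, hs, ht⟩ := next 0
    rw [show phase E 0 p = .announce (input p) from E.state_zero p] at ht
    obtain ⟨⟨r, -, h⟩, -⟩ := step t (some p) (RegOp.write (some (input p))) _ hs
      (congrArg ((verifierConsensus S x n Val).act p) ht)
    exact ⟨t + 1, (congrFun h p).trans (Function.update_self ..)⟩
  have h₂ : ∃ t, phase E t p = .append := by
    obtain ⟨s, hs⟩ := h₁
    obtain ⟨t, -, hs, ht⟩ := hs ▸ next s
    obtain ⟨⟨r, -, h⟩, -⟩ := step t none (DenyOp.prove x) _ hs
      (congrArg ((verifierConsensus S x n Val).act p) ht)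
    exact ⟨t + 1, (congrFun h p).trans (Function.update_self ..)⟩
  have h₃ : ∃ t, phase E t p = .retry ∧ ∃ s, ValidAppend (deny E) s x := by
    obtain ⟨s, hs⟩ := h₂
    obtain ⟨t, -, hs, ht⟩ := hs ▸ next s
    obtain ⟨⟨r, hr, h⟩, -⟩ := step t none (DenyOp.append x) _ hs
      (congrArg ((verifierConsensus S x n Val).act p) ht)
    refine ⟨t + 1, (congrFun h p).trans (Function.update_self ..), t, p, ?_⟩
    rcases (deny_legal E).append_validity t p x r hr with ⟨rfl, -⟩ | ⟨-, hno⟩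
    · exact hr
    · exact absurd ⟨Finset.mem_univ p, hx⟩ hno
  have h₄ : ∃ t, phase E t p = .collect := by
    obtain ⟨s, hs, a, ha⟩ := h₃
    obtain ⟨T, hT⟩ := (deny_legal E).progress a x ha
    by_contra! hcon
    have hretry : ∀ t ≥ s, phase E t p = .retry := by
      intro t ht
      induction t, ht using Nat.le_induction with
      | base => exact hs
      | succ t _ ih =>
        by_cases hsched : E.sched t = some p
        · obtain ⟨⟨r, -, h⟩, -⟩ := step t none (DenyOp.prove x) _ hsched
            (congrArg ((verifierConsensus S x n Val).act p) ih)
          have h := (congrFun h p).trans (Function.update_self ..)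
          cases r with
          | reject => exact absurd h (hcon (t + 1))
          | accept => exact h
          | proofs l => exact h
        · rw [phase_succ_of_not_scheduled E hsched, ih]
    obtain ⟨t, ht, hsched⟩ := hp (max s T)
    obtain ⟨⟨r, hr, h⟩, -⟩ := step t none (DenyOp.prove x) _ hsched
      (congrArg ((verifierConsensus S x n Val).act p) (hretry t (by omega)))
    obtain rfl := hT t (by omega) p (Finset.mem_univ p) r hr
    exact hcon (t + 1) ((congrFun h p).trans (Function.update_self ..))
  have h₅ : ∃ t j, phase E t p = .fetch j := by
    obtain ⟨s, hs⟩ := h₄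
    obtain ⟨t, -, hs, ht⟩ := hs ▸ next s
    obtain ⟨⟨r, hr, h⟩, -⟩ := step t none DenyOp.read _ hs
      (congrArg ((verifierConsensus S x n Val).act p) ht)
    obtain ⟨l, rfl, hl⟩ := (deny_legal E).read_validity t p r hr
    have hinv := phaseInv E t p
    rw [ht] at hinv
    obtain ⟨j, hj⟩ := exists_winner?_eq hinv.2
    rw [← winner?_eq_of_perm hl] at hj
    refine ⟨t + 1, j, (congrFun h p).trans ((Function.update_self ..).trans ?_)⟩
    change (winner? l).elim _ _ = _
    rw [hj]
    rfl
  obtain ⟨s, j, hs⟩ := h₅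
  obtain ⟨t, -, hs, ht⟩ := hs ▸ next s
  obtain ⟨⟨r, hr, h⟩, -⟩ := step t (some j) RegOp.read _ hs
    (congrArg ((verifierConsensus S x n Val).act p) ht)
  have hinv := phaseInv E t p
  rw [ht] at hinv
  obtain ⟨content, hstep, hcontent⟩ := exists_content E
  obtain ⟨-, hj, -⟩ := (hcontent j t).resolve_left
    fun h => phase_winner_ne_announce E hinv.2 _ h.1
  have hr' : reg E j t = some ⟨p, .read, r⟩ := hr
  have hstep := hstep j t
  rw [hr', hj] at hstep
  obtain rfl : r = .value (some (input j)) := hstep.1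
  refine ⟨input j, t + 1, ⟨t, Nat.lt_succ_self t, hs⟩, ?_⟩
  exact congrArg ((verifierConsensus S x n Val).act p)
    ((congrFun h p).trans (Function.update_self ..))

end verifierConsensus

theorem consensusSolvable_kDenyList {V : Type} {S : Set V} (hS : S.Nonempty) (Val : Type) (k : ℕ) :
    ConsensusSolvable (kDenyList S k) Val k := by
  obtain ⟨x, hx⟩ := hS
  refine ⟨verifierConsensus S x k Val, ?_, ?_⟩
  · rintro (_ | i)
    · exact .inl ⟨Finset.univ, Finset.univ, Finset.card_fin k, rfl⟩
    · exact .inr ⟨Option Val, none, rfl⟩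
  · exact ⟨fun _ E _ _ _ h => verifierConsensus.validity E h,
      fun _ E _ _ _ _ _ _ hv hw => verifierConsensus.agreement E hv hw,
      fun _ E _ hp => verifierConsensus.termination E hx hp⟩

theorem mainTheorem1 {V : Type} (S : Set V) (hS : S.Nonempty) (Val : Type) [Nontrivial Val]
    (k : ℕ) (hk : 1 ≤ k) : HasConsensusNumber (kDenyList S k) Val k := by
  refine ⟨consensusSolvable_kDenyList hS Val k, fun n hn => ?_⟩
  by_contra! hkn
  exact not_consensusSolvable_kDenyList S hk hkn hn
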